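/- Let $v_i$, $i\in\mathcal S$, be finitely many (at least one) vectors in $\mathbb R^p$ such that no $v_i$ lies in the convex hull of $\{v_j : j\neq i\}$, let $g:\mathbb R^p\to\mathbb R$ be convex and continuously differentiable, and let $f(x)=\max_{i\in\mathcal S}\langle v_i,x\rangle+g(x)$. The pattern of $x\in\mathbb R^p$ is the index set $I(x)=\operatorname{argmax}_{i\in\mathcal S}\langle v_i,x\rangle$, the set of all patterns is $\mathfrak P=\{I(x):x\in\mathbb R^p\}$, and the limiting pattern of $u$ with respect to $x$ is $I_x(u)=\operatorname{argmax}_{i\in I(x)}\langle v_i,u\rangle$. Consider the linear model $y=X\beta^0+\varepsilon$ with $n$ observations, where $p$ is fixed, the rows $X_1,X_2,\dots$ of the design matrix are i.i.d. centered random vectors in $\mathbb R^p$ with finite second moments and positive definite covariance matrix $C$, the errors $\varepsilon_1,\varepsilon_2,\dots$ are i.i.d. centered random variables with variance $\sigma^2\in(0,\infty)$, and the sequences $(X_i)$ and $(\varepsilon_i)$ are independent of each other. For each $n$ let $\hat\beta_n$ be a random vector that almost surely minimizes $\beta\mapsto\frac12\|y-X\beta\|_2^2+\sqrt n\,f(\beta)$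 over $\mathbb R^p$ whenever this function has a minimizer. Let $W\sim\mathcal N(0,\sigma^2C)$ and let $\hat u$ be, almost surely, the minimizer over $u\in\mathbb R^p$ of $$V(u)=\tfrac12u^TCu-u^TW+f'(\beta^0;u),\qquad f'(\beta^0;u)=\lim_{t\downarrow0}\frac{f(\beta^0+tu)-f(\beta^0)}{t}.$$ Then, for every $u\in\mathbb R^p$, $I(\beta^0+\varepsilon u)=I_{\beta^0}(u)$ for all sufficiently small $\varepsilon>0$, that is, $I_{\beta^0}(u)=\lim_{\varepsilon\downarrow0}I(\beta^0+\varepsilon u)$; and for every pattern $\mathfrak p\in\mathfrak P$, $$\mathbb P[I(\hat\beta_n)=\mathfrak p]\xrightarrow[n\to\infty]{}\mathbb P[I_{\beta^0}(\hat u)=\mathfrak p].$$ -/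

import Mathlib

open MeasureTheory ProbabilityTheory Filter Topology
open scoped RealInnerProductSpace Matrix ENNReal

namespace PatternConvergence

noncomputable section

/-- The penalty `f(x) = max {⟨v i, x⟩ : i ∈ ι} + g(x)` with finite nonempty index set `ι`. -/
def penalty {ι : Type*} [Fintype ι] [Nonempty ι] {p : ℕ}
    (v : ι → EuclideanSpace ℝ (Fin p)) (g : EuclideanSpace ℝ (Fin p) → ℝ)
    (x : EuclideanSpace ℝ (Fin p)) : ℝ :=
  Finset.univ.sup' Finset.univ_nonempty (fun i : ι => ⟪v i, x⟫) + g x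

/-- The pattern `I(x) = argmax_{i ∈ ι} ⟨v i, x⟩`, a set of indices. -/
def pattern {ι : Type*} {p : ℕ} (v : ι → EuclideanSpace ℝ (Fin p))
    (x : EuclideanSpace ℝ (Fin p)) : Set ι :=
  {i | ∀ j, ⟪v j, x⟫ ≤ ⟪v i, x⟫}

/-- The limiting pattern `I_x(u) = argmax_{i ∈ I(x)} ⟨v i, u⟩` of `u` with respect to `x`. -/
def limitingPattern {ι : Type*} {p : ℕ} (v : ι → EuclideanSpace ℝ (Fin p))
    (x u : EuclideanSpace ℝ (Fin p)) : Set ι :=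
  {i | i ∈ pattern v x ∧ ∀ j ∈ pattern v x, ⟪v j, u⟫ ≤ ⟪v i, u⟫}

/-- The one-sided directional derivative `f'(x; u) = lim_{t ↓ 0} (f(x + t u) - f(x)) / t`. -/
def dirDeriv {p : ℕ} (f : EuclideanSpace ℝ (Fin p) → ℝ) (x u : EuclideanSpace ℝ (Fin p)) : ℝ :=
  limUnder (𝓝[>] (0 : ℝ)) fun t => (f (x + t • u) - f x) / t

/-- The design matrix with rows `X 0, …, X (n - 1)`. -/
def designMatrix {Ω : Type*} {p : ℕ} (X : ℕ → Ω → EuclideanSpace ℝ (Fin p)) (n : ℕ) (ω : Ω) :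
    Matrix (Fin n) (Fin p) ℝ :=
  Matrix.of fun i j => X i ω j

/-- The response vector `y = X β⁰ + ε` of the linear model with `n` observations. -/
def response {Ω : Type*} {p : ℕ} (X : ℕ → Ω → EuclideanSpace ℝ (Fin p)) (ε : ℕ → Ω → ℝ)
    (β₀ : EuclideanSpace ℝ (Fin p)) (n : ℕ) (ω : Ω) : Fin n → ℝ :=
  designMatrix X n ω *ᵥ β₀.ofLp + fun i : Fin n => ε i ω

/-- The objective `½ ‖y - X β‖₂² + √n f(β)` of the regularized least squares problem. -/
def objective {Ω : Type*} {p : ℕ} (X : ℕ → Ω → EuclideanSpace ℝ (Fin p)) (ε : ℕ → Ω → ℝ)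
    (β₀ : EuclideanSpace ℝ (Fin p)) (f : EuclideanSpace ℝ (Fin p) → ℝ) (n : ℕ) (ω : Ω)
    (β : EuclideanSpace ℝ (Fin p)) : ℝ :=
  1 / 2 * ‖WithLp.toLp 2 (response X ε β₀ n ω - designMatrix X n ω *ᵥ β.ofLp)‖ ^ 2
    + √(n : ℝ) * f β

/-- The limiting objective `V(u) = ½ uᵀ C u - uᵀ w + f'(β⁰; u)`. -/
def limitObjective {p : ℕ} (C : Matrix (Fin p) (Fin p) ℝ) (β₀ : EuclideanSpace ℝ (Fin p))
    (f : EuclideanSpace ℝ (Fin p) → ℝ) (w u : EuclideanSpace ℝ (Fin p)) : ℝ :=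
  1 / 2 * (u.ofLp ⬝ᵥ C *ᵥ u.ofLp) - u.ofLp ⬝ᵥ w.ofLp + dirDeriv f β₀ u

end

end PatternConvergence

/-!
In the local coordinate `u = √n (β - β₀)` the regularized least squares objective is, up to an
additive constant, `½ ⟪Aₙ u, u⟫ - ⟪wₙ, u⟫` plus a difference quotient of the penalty `f` at `β₀`
with step `1 / √n`. Here `Aₙ` is the empirical second moment operator, which tends to `C` by the
strong law of large numbers, and `wₙ` is the rescaled noise, which tends in distribution to
`W ∼ 𝒩(0, σ² C)` by the central limit theorem. Hence the pair `(wₙ, Aₙ)` converges in distribution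
to `(W, C)`, and everything else is a deterministic stability statement near a realization `(w, C)`.

*Stability of the minimizer.* Since `f` is convex, its difference quotients lie above the
directional derivative, and the limiting objective grows quadratically away from its minimizer `û`.
Together these force the minimizers of nearby objectives to exist and to be close to `û`
(`eventually_localObjective_lt`, `tendsto_snd_minimizerFilter`).

*Stability of the pattern.* Closeness to `û` alone only shows that the pattern of a minimizer is
contained in the limiting pattern `s` of `û`. Suppose that it were a proper subset `r`. The subspace
on which the `v i`, `i ∈ s`, agree is then a proper subspace of the one belonging to `r`, so by a
dimension count the latter contains a direction `d ≠ 0` orthogonal to the image under `C` of the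
former. The penalty is differentiable along `d` at the minimizer, and the first-order condition
there tends to a linear equation `⟪w, d⟫ = const`. So the pattern is stable unless `w` lies on one
of finitely many hyperplanes (`eventually_pattern_eq_of_isMinOn_localObjective`), and the Gaussian
vector `W` almost surely avoids these.

*Conclusion.* By an extended mapping principle (`measure_le_liminf_of_tendstoInDistribution`), the
probability that the limiting pattern of `û` lies in a set `Q` of patterns is at most the lower
limit of the probability that the pattern of the estimator does. Taking for `Q` a single pattern
and then its complement gives the two halves of the convergence.
-/

namespace PatternConvergence

local notation "𝐄[" p "]" => EuclideanSpace ℝ (Fin p)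

/-! ### Patterns -/

section Pattern

variable {ι : Type*} {p : ℕ} {v : ι → 𝐄[p]}

theorem pattern_nonempty [Finite ι] [Nonempty ι] (v : ι → 𝐄[p])
    (x : 𝐄[p]) : (pattern v x).Nonempty :=
  Finite.exists_max fun i => ⟪v i, x⟫

theorem inner_eq_of_mem_pattern {x : 𝐄[p]} {i j : ι}
    (hi : i ∈ pattern v x) (hj : j ∈ pattern v x) : ⟪v i, x⟫ = ⟪v j, x⟫ :=
  le_antisymm (hj i) (hi j)

theorem exists_inner_lt_of_notMem_pattern {x : 𝐄[p]} {i : ι}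
    (hi : i ∉ pattern v x) : ∃ j, ⟪v i, x⟫ < ⟪v j, x⟫ := by
  simpa [pattern] using hi

/-- Along points `x + t u` with `t ↓ 0` and `u → u₀`, no index outside the limiting pattern of `u₀`
remains active. -/
theorem eventually_pattern_subset_limitingPattern [Finite ι] {α : Type*} {l : Filter α}
    (x : 𝐄[p]) {t : α → ℝ} {u : α → 𝐄[p]}
    {u₀ : 𝐄[p]} (ht : Tendsto t l (𝓝[>] 0)) (hu : Tendsto u l (𝓝 u₀)) :
    ∀ᶠ a in l, pattern v (x + t a • u a) ⊆ limitingPattern v x u₀ := by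
  have ht0 : Tendsto t l (𝓝 0) := ht.mono_right nhdsWithin_le_nhds
  have hpos : ∀ᶠ a in l, 0 < t a := ht.eventually self_mem_nhdsWithin
  have hx : Tendsto (fun a => x + t a • u a) l (𝓝 x) := by
    simpa using tendsto_const_nhds.add (ht0.smul hu)
  have key : ∀ i, ∀ᶠ a in l, i ∉ limitingPattern v x u₀ → i ∉ pattern v (x + t a • u a) := by
    intro i
    by_cases hi : i ∈ pattern v x
    · by_cases hi' : i ∈ limitingPattern v x u₀
      · exact .of_forall fun a h => absurd hi' h
      obtain ⟨j, hj, hlt⟩ : ∃ j ∈ pattern v x, ⟪v i, u₀⟫ < ⟪v j, u₀⟫ := by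
        simpa [limitingPattern, hi] using hi'
      have := (tendsto_const_nhds.inner hu).eventually_lt (tendsto_const_nhds.inner hu) hlt
      filter_upwards [this, hpos] with a ha hta _ hmem
      have h1 := hmem j
      simp only [inner_add_right, real_inner_smul_right, inner_eq_of_mem_pattern hi hj] at h1
      nlinarith
    · obtain ⟨j, hlt⟩ := exists_inner_lt_of_notMem_pattern hi
      have := (tendsto_const_nhds.inner hx).eventually_lt (tendsto_const_nhds.inner hx) hlt
      filter_upwards [this] with a ha _ hmem
      exact absurd (hmem j) (not_le.2 ha)
  filter_upwards [eventually_all.2 key] with a ha i hi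
  by_contra h
  exact ha i h hi

theorem eventually_pattern_eq_limitingPattern [Finite ι] [Nonempty ι]
    (x u : 𝐄[p]) :
    ∀ᶠ t in 𝓝[>] (0 : ℝ), pattern v (x + t • u) = limitingPattern v x u := by
  filter_upwards [eventually_pattern_subset_limitingPattern (v := v) x tendsto_id
    (tendsto_const_nhds (x := u)), self_mem_nhdsWithin] with t hsub ht
  refine hsub.antisymm fun i hi j => ?_
  obtain ⟨k, hk⟩ := pattern_nonempty v (x + t • u)
  refine (hk j).trans ?_
  have h1 := inner_eq_of_mem_pattern (hsub hk).1 hi.1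
  have h2 := hi.2 k (hsub hk).1
  have ht' : (0 : ℝ) < t := ht
  simp only [id, inner_add_right, real_inner_smul_right, h1]
  nlinarith

/-- The subspace of points on which all `v i`, `i ∈ s`, take the same value. -/
def tieSpace (v : ι → 𝐄[p]) (s : Set ι) :
    Submodule ℝ (𝐄[p]) where
  carrier := {u | ∀ i ∈ s, ∀ j ∈ s, ⟪v i, u⟫ = ⟪v j, u⟫}
  add_mem' {a b} ha hb i hi j hj := by
    rw [inner_add_right, inner_add_right, ha i hi j hj, hb i hi j hj]
  zero_mem' i _ j _ := by simp
  smul_mem' c a ha i hi j hj := by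
    rw [real_inner_smul_right, real_inner_smul_right, ha i hi j hj]

theorem mem_tieSpace_pattern (x : 𝐄[p]) : x ∈ tieSpace v (pattern v x) :=
  fun _ hi _ hj => inner_eq_of_mem_pattern hi hj

theorem mem_tieSpace_limitingPattern (x u : 𝐄[p]) :
    u ∈ tieSpace v (limitingPattern v x u) :=
  fun i hi j hj => le_antisymm (hj.2 i hi.1) (hi.2 j hj.1)

/-- Shrinking a set of indices to a pattern strictly enlarges the tie space: a point with the
smaller pattern separates the lost indices from the remaining ones. -/
theorem tieSpace_lt_of_pattern_ssubset [Finite ι] [Nonempty ι] {x : 𝐄[p]}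
    {s : Set ι} (h : pattern v x ⊂ s) : tieSpace v s < tieSpace v (pattern v x) := by
  refine lt_of_le_of_ne (fun u hu i hi j hj => hu i (h.1 hi) j (h.1 hj)) fun heq => ?_
  obtain ⟨j, hj, hj'⟩ := Set.exists_of_ssubset h
  obtain ⟨i, hi⟩ := pattern_nonempty v x
  have hx : x ∈ tieSpace v s := heq ▸ mem_tieSpace_pattern x
  exact hj' fun k => (hi k).trans_eq (hx i (h.1 hi) j hj)

/-- A hyperplane normal attached to a pair of tie spaces `tieSpace v s < tieSpace v r`: a nonzero
direction in the larger one which is orthogonal to the image of the smaller one under `T`. It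
exists since the image has dimension less than that of `tieSpace v r`. -/
theorem exists_ne_zero_mem_tieSpace_inner_eq_zero
    (T : 𝐄[p] →L[ℝ] 𝐄[p]) {s r : Set ι}
    (h : tieSpace v s < tieSpace v r) :
    ∃ d ≠ 0, d ∈ tieSpace v r ∧ ∀ u ∈ tieSpace v s, ⟪T u, d⟫ = 0 := by
  let K := (tieSpace v s).map (T : 𝐄[p] →ₗ[ℝ] 𝐄[p])
  let f : tieSpace v r →ₗ[ℝ] K := K.orthogonalProjectionOnto.toLinearMap ∘ₗ (tieSpace v r).subtype
  have hdim : Module.finrank ℝ K < Module.finrank ℝ (tieSpace v r) :=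
    (Submodule.finrank_map_le _ _).trans_lt (Submodule.finrank_lt_finrank_of_lt h)
  obtain ⟨d, hd, hd0⟩ := (Submodule.ne_bot_iff _).1 (f.ker_ne_bot_of_finrank_lt hdim)
  refine ⟨d, by simpa using hd0, d.2, fun u hu => ?_⟩
  have hdK : (d : 𝐄[p]) ∈ Kᗮ :=
    Submodule.orthogonalProjectionOnto_eq_zero_iff.1 (by simpa [f] using hd)
  exact hdK (T u) (Submodule.mem_map_of_mem hu)

end Pattern

/-! ### The penalty -/

section Penalty

variable {ι : Type*} [Fintype ι] [Nonempty ι] {p : ℕ} {v : ι → 𝐄[p]}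
  {g : 𝐄[p] → ℝ}

theorem penalty_eq_of_mem_pattern {x : 𝐄[p]} {i : ι} (hi : i ∈ pattern v x) :
    penalty v g x = ⟪v i, x⟫ + g x := by
  rw [penalty, le_antisymm (Finset.sup'_le _ _ fun j _ => hi j)
    (Finset.le_sup' (fun j => ⟪v j, x⟫) (Finset.mem_univ i))]

theorem convexOn_penalty (hg : ConvexOn ℝ Set.univ g) : ConvexOn ℝ Set.univ (penalty v g) := by
  refine ConvexOn.add ⟨convex_univ, fun x _ y _ a b ha hb _ => ?_⟩ hg
  refine Finset.sup'_le _ _ fun i _ => ?_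
  rw [inner_add_right, real_inner_smul_right, real_inner_smul_right]
  exact add_le_add
    (mul_le_mul_of_nonneg_left (Finset.le_sup' (fun j => ⟪v j, x⟫) (Finset.mem_univ i)) ha)
    (mul_le_mul_of_nonneg_left (Finset.le_sup' (fun j => ⟪v j, y⟫) (Finset.mem_univ i)) hb)

theorem continuous_penalty (hg : Continuous g) : Continuous (penalty v g) := by
  unfold penalty
  exact (Continuous.finset_sup'_apply _ fun i _ => by fun_prop).add hg

/-- In a direction that keeps the active indices tied, the penalty is differentiable: the active
linear functions move together, and the inactive ones stay inactive. -/
theorem hasDerivAt_penalty_of_mem_tieSpace (hg : Differentiable ℝ g)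
    {x d : 𝐄[p]} (hd : d ∈ tieSpace v (pattern v x)) {i : ι}
    (hi : i ∈ pattern v x) :
    HasDerivAt (fun s : ℝ => penalty v g (x + s • d)) (⟪v i, d⟫ + fderiv ℝ g x d) 0 := by
  have hline : HasDerivAt (fun s : ℝ => x + s • d) d 0 := by
    simpa using ((hasDerivAt_id (0 : ℝ)).smul_const d).const_add x
  have hgd : HasDerivAt (fun s : ℝ => g (x + s • d)) (fderiv ℝ g x d) 0 := by
    have : HasFDerivAt g (fderiv ℝ g x) (x + (0 : ℝ) • d) := by simpa using (hg x).hasFDerivAt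
    exact this.comp_hasDerivAt 0 hline
  have hvd : HasDerivAt (fun s : ℝ => ⟪v i, x + s • d⟫) ⟪v i, d⟫ 0 := by
    simpa using (hasDerivAt_const (0 : ℝ) (v i)).inner ℝ hline
  refine (hvd.add hgd).congr_of_eventuallyEq ?_
  have hact : ∀ j, ∀ᶠ s in 𝓝 (0 : ℝ), ⟪v j, x + s • d⟫ ≤ ⟪v i, x + s • d⟫ := by
    intro j
    by_cases hj : j ∈ pattern v x
    · refine .of_forall fun s => le_of_eq ?_
      simp only [inner_add_right, real_inner_smul_right, inner_eq_of_mem_pattern hi hj,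
        hd i hi j hj]
    · obtain ⟨k, hk⟩ := exists_inner_lt_of_notMem_pattern hj
      have hlt : ⟪v j, x + (0 : ℝ) • d⟫ < ⟪v i, x + (0 : ℝ) • d⟫ := by
        simpa using hk.trans_le (hi k)
      have hc : ∀ k, ContinuousAt (fun s : ℝ => ⟪v k, x + s • d⟫) 0 := fun k => by fun_prop
      exact ((hc j).eventually_lt (hc i) hlt).mono fun s hs => hs.le
  filter_upwards [eventually_all.2 hact] with s hs
  exact penalty_eq_of_mem_pattern hs

end Penalty

/-! ### Directional derivatives of convex functions -/

section DirDeriv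

variable {p : ℕ} {f : 𝐄[p] → ℝ}

theorem convexOn_comp_line (hf : ConvexOn ℝ Set.univ f) (x u : 𝐄[p]) :
    ConvexOn ℝ Set.univ fun t : ℝ => f (x + t • u) := by
  have := hf.comp_affineMap (AffineMap.lineMap x (x + u) : ℝ →ᵃ[ℝ] 𝐄[p])
  simpa [Function.comp_def, AffineMap.lineMap_apply, add_comm] using this

theorem slope_comp_line_zero (f : 𝐄[p] → ℝ) (x u : 𝐄[p]) :
    slope (fun t : ℝ => f (x + t • u)) 0 = fun t => (f (x + t • u) - f x) / t := by
  ext t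
  simp [slope_def_field]

/-- For a convex function the limit defining `dirDeriv` exists. -/
theorem tendsto_dirDeriv (hf : ConvexOn ℝ Set.univ f) (x u : 𝐄[p]) :
    Tendsto (fun t : ℝ => (f (x + t • u) - f x) / t) (𝓝[>] 0) (𝓝 (dirDeriv f x u)) := by
  have h := (convexOn_comp_line hf x u).hasDerivWithinAt_rightDeriv_of_mem_interior
    (x := 0) (by simp)
  rw [hasDerivWithinAt_iff_tendsto_slope' (by simp), slope_comp_line_zero] at h
  exact tendsto_nhds_limUnder ⟨_, h⟩

theorem dirDeriv_le (hf : ConvexOn ℝ Set.univ f) (x u : 𝐄[p]) {t : ℝ}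
    (ht : 0 < t) : dirDeriv f x u ≤ (f (x + t • u) - f x) / t := by
  have hlim := tendsto_dirDeriv hf x u
  have := (convexOn_comp_line hf x u).le_slope_of_hasDerivWithinAt_Ioi (x := 0) (y := t)
    (Set.mem_univ _) (Set.mem_univ _) ht (f' := dirDeriv f x u) (by
      rwa [hasDerivWithinAt_iff_tendsto_slope' (by simp), slope_comp_line_zero])
  rwa [slope_comp_line_zero] at this

theorem convexOn_dirDeriv (hf : ConvexOn ℝ Set.univ f) (x : 𝐄[p]) :
    ConvexOn ℝ Set.univ (dirDeriv f x) := by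
  refine ⟨convex_univ, fun u _ w _ a b ha hb hab => ?_⟩
  refine le_of_tendsto_of_tendsto (tendsto_dirDeriv hf x _)
    (((tendsto_dirDeriv hf x u).const_smul a).add ((tendsto_dirDeriv hf x w).const_smul b)) ?_
  filter_upwards [self_mem_nhdsWithin] with t ht
  have ht' : (0 : ℝ) < t := ht
  have h := hf.2 (Set.mem_univ (x + t • u)) (Set.mem_univ (x + t • w)) ha hb hab
  have hx : a • (x + t • u) + b • (x + t • w) = x + t • (a • u + b • w) := by
    calc a • (x + t • u) + b • (x + t • w) = (a + b) • x + t • (a • u + b • w) := by module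
      _ = _ := by rw [hab, one_smul]
  rw [hx] at h
  simp only [smul_eq_mul] at h ⊢
  rw [← mul_div_assoc, ← mul_div_assoc, ← add_div]
  gcongr
  linear_combination h + f x * hab

end DirDeriv

/-! ### The rescaled objective and its minimizers -/

section LocalObjective

variable {p : ℕ}

/-- The least squares objective in the local coordinate `u`, where `β = β₀ + t u` and `t = 1 / √n`,
up to an additive constant. The triple `z = (t, A, w)` collects the scale, the empirical second
moment operator and the rescaled noise. -/
noncomputable def localObjective (f : 𝐄[p] → ℝ) (β₀ : 𝐄[p])
    (z : ℝ × (𝐄[p] →L[ℝ] 𝐄[p]) × 𝐄[p]) (u : 𝐄[p]) : ℝ :=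
  1 / 2 * ⟪z.2.1 u, u⟫ - ⟪z.2.2, u⟫ + (f (β₀ + z.1 • u) - f β₀) / z.1

/-- A quadratic function plus a convex function grows quadratically away from a minimizer. -/
theorem quadratic_growth_of_isMinOn {D : 𝐄[p] → ℝ} (hD : ConvexOn ℝ Set.univ D)
    {T : 𝐄[p] →L[ℝ] 𝐄[p]}
    (hT : ∀ x y, ⟪T x, y⟫ = ⟪x, T y⟫) {w u₀ : 𝐄[p]}
    (hmin : IsMinOn (fun u => 1 / 2 * ⟪T u, u⟫ - ⟪w, u⟫ + D u) Set.univ u₀) (u : 𝐄[p]) :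
    1 / 2 * ⟪T u₀, u₀⟫ - ⟪w, u₀⟫ + D u₀ + 1 / 2 * ⟪T (u - u₀), u - u₀⟫
      ≤ 1 / 2 * ⟪T u, u⟫ - ⟪w, u⟫ + D u := by
  have hsymm : ⟪T u, u₀⟫ = ⟪T u₀, u⟫ := by rw [hT, real_inner_comm]
  have hlim : Tendsto (fun s : ℝ => 1 / 2 * ⟪T u₀, u₀⟫ - ⟪w, u₀⟫ + D u₀
      + (1 - s) * (1 / 2 * ⟪T (u - u₀), u - u₀⟫)) (𝓝[>] 0) (𝓝 (1 / 2 * ⟪T u₀, u₀⟫ - ⟪w, u₀⟫ + D u₀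
      + 1 / 2 * ⟪T (u - u₀), u - u₀⟫)) := by
    refine Tendsto.mono_left ?_ nhdsWithin_le_nhds
    refine Continuous.tendsto' (by fun_prop) _ _ (by ring)
  refine le_of_tendsto hlim ?_
  filter_upwards [Ioo_mem_nhdsGT (zero_lt_one' ℝ)] with s hs
  have h1 := hmin (Set.mem_univ ((1 - s) • u₀ + s • u))
  have h2 := hD.2 (Set.mem_univ u₀) (Set.mem_univ u) (by linarith [hs.2] : (0 : ℝ) ≤ 1 - s)
    hs.1.le (by ring)
  simp only [Set.mem_ofPred_eq, map_add, map_smul, map_sub, inner_add_left, inner_add_right,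
    inner_sub_left, inner_sub_right, real_inner_smul_left, real_inner_smul_right, smul_eq_mul,
    hsymm] at h1 h2 ⊢
  refine le_of_mul_le_mul_left ?_ hs.1
  linear_combination h1 + h2

/-- Near the limit parameter, a local objective falls below the limiting objective only by a
quadratic error with a small coefficient, uniformly in `u`. -/
theorem localObjective_ge {f : 𝐄[p] → ℝ} (hf : ConvexOn ℝ Set.univ f) (β₀ : 𝐄[p])
    (T : 𝐄[p] →L[ℝ] 𝐄[p]) (w : 𝐄[p])
    {z : ℝ × (𝐄[p] →L[ℝ] 𝐄[p]) × 𝐄[p]} (hz : 0 < z.1) (u : 𝐄[p]) :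
    1 / 2 * ⟪T u, u⟫ - ⟪w, u⟫ + dirDeriv f β₀ u - (1 / 2 * ‖z.2.1 - T‖ * ‖u‖ ^ 2
      + ‖z.2.2 - w‖ * ‖u‖) ≤ localObjective f β₀ z u := by
  have h1 : -(‖z.2.1 - T‖ * ‖u‖ ^ 2) ≤ ⟪z.2.1 u, u⟫ - ⟪T u, u⟫ := by
    rw [← inner_sub_left, ← sub_apply]
    have := (abs_le.1 (abs_real_inner_le_norm ((z.2.1 - T) u) u)).1
    have h' := mul_le_mul_of_nonneg_right ((z.2.1 - T).le_opNorm u) (norm_nonneg u)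
    linear_combination this + h'
  have h2 : ⟪z.2.2, u⟫ - ⟪w, u⟫ ≤ ‖z.2.2 - w‖ * ‖u‖ := by
    rw [← inner_sub_left]
    exact real_inner_le_norm _ _
  have h3 := dirDeriv_le hf β₀ u hz
  rw [localObjective]
  linear_combination 1 / 2 * h1 + h2 + h3

theorem tendsto_localObjective {f : 𝐄[p] → ℝ} (hf : ConvexOn ℝ Set.univ f) (β₀ : 𝐄[p])
    (T : 𝐄[p] →L[ℝ] 𝐄[p])
    (w u : 𝐄[p]) : Tendsto (fun z => localObjective f β₀ z u) (𝓝[>] 0 ×ˢ 𝓝 (T, w))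
      (𝓝 (1 / 2 * ⟪T u, u⟫ - ⟪w, u⟫ + dirDeriv f β₀ u)) := by
  have hA : Tendsto (fun z : ℝ × (𝐄[p] →L[ℝ] 𝐄[p]) × 𝐄[p] => 1 / 2 * ⟪z.2.1 u, u⟫ - ⟪z.2.2, u⟫)
      (𝓝[>] 0 ×ˢ 𝓝 (T, w)) (𝓝 (1 / 2 * ⟪T u, u⟫ - ⟪w, u⟫)) := by
    have : Continuous fun y : (𝐄[p] →L[ℝ] 𝐄[p]) × 𝐄[p] => 1 / 2 * ⟪y.1 u, u⟫ - ⟪y.2, u⟫ := by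
      fun_prop
    exact (this.tendsto (T, w)).comp tendsto_snd
  exact hA.add ((tendsto_dirDeriv hf β₀ u).comp tendsto_fst)

/-- Uniform strict growth of the local objectives away from the minimizer `u₀` of their limit.
Convexity puts every difference quotient of `f` above its limit, so pointwise convergence is only
needed at `u₀`. -/
theorem eventually_localObjective_lt {f : 𝐄[p] → ℝ} (hf : ConvexOn ℝ Set.univ f) {β₀ : 𝐄[p]}
    {T : 𝐄[p] →L[ℝ] 𝐄[p]} (hT : ∀ x y, ⟪T x, y⟫ = ⟪x, T y⟫) {c : ℝ} (hc : 0 < c)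
    (hcT : ∀ x, c * ‖x‖ ^ 2 ≤ ⟪T x, x⟫) {w u₀ : 𝐄[p]}
    (hmin : IsMinOn (fun u => 1 / 2 * ⟪T u, u⟫ - ⟪w, u⟫ + dirDeriv f β₀ u) Set.univ u₀)
    {r : ℝ} (hr : 0 < r) :
    ∀ᶠ z in 𝓝[>] 0 ×ˢ 𝓝 (T, w), ∀ u, r ≤ ‖u - u₀‖ →
      localObjective f β₀ z u₀ < localObjective f β₀ z u := by
  -- `K` bounds `‖u‖ / ‖u - u₀‖` on the region `r ≤ ‖u - u₀‖`
  set K : ℝ := ‖u₀‖ / r + 1 with hK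
  have hK0 : 0 < K := by positivity
  set δ : ℝ := c / 4 / (K ^ 2 / 2 + K / r) with hδ
  have hδ0 : 0 < δ := by positivity
  have hδK : δ * (K ^ 2 / 2 + K / r) = c / 4 := by rw [hδ]; field_simp
  have hA : ∀ᶠ z : ℝ × (𝐄[p] →L[ℝ] 𝐄[p]) × 𝐄[p] in 𝓝[>] 0 ×ˢ 𝓝 (T, w),
      ‖z.2.1 - T‖ < δ ∧ ‖z.2.2 - w‖ < δ := by
    have h1 : Tendsto (fun y : (𝐄[p] →L[ℝ] 𝐄[p]) × 𝐄[p] => ‖y.1 - T‖) (𝓝 (T, w)) (𝓝 0) :=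
      Continuous.tendsto' (by fun_prop) _ _ (by simp)
    have h2 : Tendsto (fun y : (𝐄[p] →L[ℝ] 𝐄[p]) × 𝐄[p] => ‖y.2 - w‖) (𝓝 (T, w)) (𝓝 0) :=
      Continuous.tendsto' (by fun_prop) _ _ (by simp)
    exact (((h1.comp tendsto_snd).eventually_lt_const hδ0).and
      ((h2.comp tendsto_snd).eventually_lt_const hδ0))
  have hB := (tendsto_localObjective hf β₀ T w u₀).eventually_lt_const
    (lt_add_of_pos_right _ (by positivity : 0 < c / 4 * r ^ 2))
  have hpos : ∀ᶠ z : ℝ × (𝐄[p] →L[ℝ] 𝐄[p]) × 𝐄[p] in 𝓝[>] 0 ×ˢ 𝓝 (T, w), 0 < z.1 :=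
    tendsto_fst.eventually self_mem_nhdsWithin
  filter_upwards [hA, hB, hpos] with z ⟨hz1, hz2⟩ hzB hz u hu
  have hgrow := quadratic_growth_of_isMinOn (convexOn_dirDeriv hf β₀) hT hmin u
  have hge := localObjective_ge hf β₀ T w hz u
  set ρ := ‖u - u₀‖
  have hρ : 0 < ρ := hr.trans_le hu
  have hnorm : ‖u‖ ≤ K * ρ := by
    have h1 : ‖u‖ ≤ ‖u₀‖ + ρ := by simpa using norm_add_le u₀ (u - u₀)
    have h2 : ‖u₀‖ ≤ ‖u₀‖ / r * ρ := by
      rw [div_mul_eq_mul_div, le_div_iff₀ hr]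
      gcongr
    rw [hK]
    linear_combination h1 + h2
  have hlin : ‖u‖ ≤ K / r * ρ ^ 2 := by
    refine hnorm.trans ?_
    rw [div_mul_eq_mul_div, le_div_iff₀ hr, pow_two, ← mul_assoc]
    gcongr
  have herr : 1 / 2 * ‖z.2.1 - T‖ * ‖u‖ ^ 2 + ‖z.2.2 - w‖ * ‖u‖ ≤ c / 4 * ρ ^ 2 := by
    calc _ ≤ 1 / 2 * δ * (K * ρ) ^ 2 + δ * (K / r * ρ ^ 2) := by gcongr
      _ = δ * (K ^ 2 / 2 + K / r) * ρ ^ 2 := by ring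
      _ = _ := by rw [hδK]
  have hr2 : c / 4 * r ^ 2 ≤ c / 4 * ρ ^ 2 := by gcongr
  linarith [hcT (u - u₀)]

theorem eventually_exists_isMinOn_localObjective {f : 𝐄[p] → ℝ} (hf : ConvexOn ℝ Set.univ f)
    (hfc : Continuous f) {β₀ : 𝐄[p]}
    {T : 𝐄[p] →L[ℝ] 𝐄[p]} (hT : ∀ x y, ⟪T x, y⟫ = ⟪x, T y⟫) {c : ℝ} (hc : 0 < c)
    (hcT : ∀ x, c * ‖x‖ ^ 2 ≤ ⟪T x, x⟫) {w u₀ : 𝐄[p]}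
    (hmin : IsMinOn (fun u => 1 / 2 * ⟪T u, u⟫ - ⟪w, u⟫ + dirDeriv f β₀ u) Set.univ u₀) :
    ∀ᶠ z in 𝓝[>] 0 ×ˢ 𝓝 (T, w), ∃ u, IsMinOn (localObjective f β₀ z) Set.univ u := by
  filter_upwards [eventually_localObjective_lt hf hT hc hcT hmin one_pos] with z hz
  have hcont : Continuous (localObjective f β₀ z) := by unfold localObjective; fun_prop
  obtain ⟨u, hu⟩ := hcont.exists_forall_le' u₀ (by
    filter_upwards [(isCompact_closedBall u₀ 1).compl_mem_cocompact] with u hu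
    refine (hz u ?_).le
    rw [Set.mem_compl_iff, mem_closedBall_iff_norm, not_le] at hu
    exact hu.le)
  exact ⟨u, fun y _ => hu y⟩

/-- The filter of pairs `(z, u)` in which the parameter `z = (t, A, w')` tends to `(0⁺, T, w)` and
`u` minimizes the local objective of `z`. It turns statements about all minimizers of nearby
objectives into limits along one filter. -/
noncomputable def minimizerFilter (f : 𝐄[p] → ℝ) (β₀ : 𝐄[p]) (T : 𝐄[p] →L[ℝ] 𝐄[p]) (w : 𝐄[p]) :
    Filter ((ℝ × (𝐄[p] →L[ℝ] 𝐄[p]) × 𝐄[p]) × 𝐄[p]) :=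
  comap Prod.fst (𝓝[>] 0 ×ˢ 𝓝 (T, w)) ⊓ 𝓟 {y | IsMinOn (localObjective f β₀ y.1) Set.univ y.2}

theorem eventually_minimizerFilter {f : 𝐄[p] → ℝ} {β₀ : 𝐄[p]} {T : 𝐄[p] →L[ℝ] 𝐄[p]} {w : 𝐄[p]}
    {q : (ℝ × (𝐄[p] →L[ℝ] 𝐄[p]) × 𝐄[p]) × 𝐄[p] → Prop} :
    (∀ᶠ y in minimizerFilter f β₀ T w, q y) ↔
      ∀ᶠ z in 𝓝[>] 0 ×ˢ 𝓝 (T, w), ∀ u, IsMinOn (localObjective f β₀ z) Set.univ u → q (z, u) := by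
  simp only [minimizerFilter, eventually_inf_principal, eventually_comap, Set.mem_ofPred_eq]
  refine eventually_congr (.of_forall fun z => ⟨fun h u => h (z, u) rfl, ?_⟩)
  rintro h ⟨_, u⟩ rfl
  exact h u

theorem tendsto_fst_minimizerFilter (f : 𝐄[p] → ℝ) (β₀ : 𝐄[p]) (T : 𝐄[p] →L[ℝ] 𝐄[p]) (w : 𝐄[p]) :
    Tendsto Prod.fst (minimizerFilter f β₀ T w) (𝓝[>] 0 ×ˢ 𝓝 (T, w)) :=
  tendsto_comap.mono_left inf_le_left

theorem tendsto_snd_minimizerFilter {f : 𝐄[p] → ℝ} (hf : ConvexOn ℝ Set.univ f) {β₀ : 𝐄[p]}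
    {T : 𝐄[p] →L[ℝ] 𝐄[p]} (hT : ∀ x y, ⟪T x, y⟫ = ⟪x, T y⟫) {c : ℝ} (hc : 0 < c)
    (hcT : ∀ x, c * ‖x‖ ^ 2 ≤ ⟪T x, x⟫) {w u₀ : 𝐄[p]}
    (hmin : IsMinOn (fun u => 1 / 2 * ⟪T u, u⟫ - ⟪w, u⟫ + dirDeriv f β₀ u) Set.univ u₀) :
    Tendsto Prod.snd (minimizerFilter f β₀ T w) (𝓝 u₀) := by
  refine Metric.tendsto_nhds.2 fun r hr => eventually_minimizerFilter.2 ?_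
  filter_upwards [eventually_localObjective_lt hf hT hc hcT hmin hr] with z hz u hu
  by_contra h
  exact (hz u (by simpa [dist_eq_norm] using h)).not_ge (hu (Set.mem_univ u₀))

variable {ι : Type*} [Fintype ι] [Nonempty ι] {v : ι → 𝐄[p]} {g : 𝐄[p] → ℝ}

/-- The first-order condition at a minimizer, along a direction in which the penalty is
differentiable. -/
theorem inner_eq_of_isMinOn_localObjective (hg : Differentiable ℝ g) {β₀ : 𝐄[p]}
    {z : ℝ × (𝐄[p] →L[ℝ] 𝐄[p]) × 𝐄[p]} (hz : 0 < z.1) (hA : ∀ x y, ⟪z.2.1 x, y⟫ = ⟪x, z.2.1 y⟫)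
    {u d : 𝐄[p]}
    (hu : IsMinOn (localObjective (penalty v g) β₀ z) Set.univ u)
    (hd : d ∈ tieSpace v (pattern v (β₀ + z.1 • u))) {i : ι}
    (hi : i ∈ pattern v (β₀ + z.1 • u)) :
    ⟪z.2.1 u, d⟫ - ⟪z.2.2, d⟫ + (⟪v i, d⟫ + fderiv ℝ g (β₀ + z.1 • u) d) = 0 := by
  have hline : HasDerivAt (fun s : ℝ => u + s • d) d 0 := by
    simpa using ((hasDerivAt_id (0 : ℝ)).smul_const d).const_add u
  have hquad : HasDerivAt (fun s : ℝ => ⟪z.2.1 (u + s • d), u + s • d⟫)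
      (2 * ⟪z.2.1 u, d⟫) 0 := by
    have h := (z.2.1.hasFDerivAt.comp_hasDerivAt (0 : ℝ) hline).inner ℝ hline
    refine h.congr_deriv ?_
    simp only [Function.comp_apply, zero_smul, add_zero, hA d u, real_inner_comm d]
    ring
  have hlin : HasDerivAt (fun s : ℝ => ⟪z.2.2, u + s • d⟫) ⟪z.2.2, d⟫ 0 := by
    simpa using (hasDerivAt_const (0 : ℝ) z.2.2).inner ℝ hline
  have hpen : HasDerivAt (fun s : ℝ => penalty v g (β₀ + z.1 • (u + s • d)))
      (z.1 * (⟪v i, d⟫ + fderiv ℝ g (β₀ + z.1 • u) d)) 0 := by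
    have hs : HasDerivAt (fun s : ℝ => z.1 * s) z.1 0 := by
      simpa using (hasDerivAt_id (0 : ℝ)).const_mul z.1
    have hf := hasDerivAt_penalty_of_mem_tieSpace hg hd hi
    rw [← mul_zero z.1] at hf
    have h := hf.comp 0 hs
    rw [mul_comm z.1]
    refine h.congr_of_eventuallyEq (.of_forall fun s => ?_)
    simp only [Function.comp_apply, smul_add, smul_smul, add_assoc]
  have hder : HasDerivAt (fun s : ℝ => localObjective (penalty v g) β₀ z (u + s • d))
      (⟪z.2.1 u, d⟫ - ⟪z.2.2, d⟫ + (⟪v i, d⟫ + fderiv ℝ g (β₀ + z.1 • u) d)) 0 := by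
    refine (((hquad.const_mul (1 / 2)).sub hlin).add
      ((hpen.sub_const (penalty v g β₀)).div_const z.1)).congr_deriv ?_
    field_simp
  refine IsLocalMin.hasDerivAt_eq_zero (.of_forall fun s => ?_) hder
  simpa using hu (Set.mem_univ (u + s • d))

/-- Stability of the pattern: minimizers of nearby local objectives have the limiting pattern of
the minimizer `u₀` of the limit, provided `w` avoids finitely many hyperplanes. -/
theorem eventually_pattern_eq_of_isMinOn_localObjective (hg : ContDiff ℝ 1 g)
    (hgc : ConvexOn ℝ Set.univ g) {β₀ : 𝐄[p]} {T : 𝐄[p] →L[ℝ] 𝐄[p]}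
    (hT : ∀ x y, ⟪T x, y⟫ = ⟪x, T y⟫) {c : ℝ} (hc : 0 < c)
    (hcT : ∀ x, c * ‖x‖ ^ 2 ≤ ⟪T x, x⟫) {w u₀ : 𝐄[p]}
    (hmin : IsMinOn (fun u => 1 / 2 * ⟪T u, u⟫ - ⟪w, u⟫ + dirDeriv (penalty v g) β₀ u) Set.univ u₀)
    (hgen : ∀ r, tieSpace v (limitingPattern v β₀ u₀) < tieSpace v r → ∃ d ∈ tieSpace v r,
      (∀ u ∈ tieSpace v (limitingPattern v β₀ u₀), ⟪T u, d⟫ = 0) ∧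
      ∀ i ∈ r, ⟪w, d⟫ ≠ ⟪v i, d⟫ + fderiv ℝ g β₀ d) :
    ∀ᶠ z in 𝓝[>] 0 ×ˢ 𝓝 (T, w), (∀ x y, ⟪z.2.1 x, y⟫ = ⟪x, z.2.1 y⟫) →
      ∀ u, IsMinOn (localObjective (penalty v g) β₀ z) Set.univ u →
        pattern v (β₀ + z.1 • u) = limitingPattern v β₀ u₀ := by
  set s := limitingPattern v β₀ u₀
  set l := minimizerFilter (penalty v g) β₀ T w
  have hfst : Tendsto Prod.fst l _ := tendsto_fst_minimizerFilter (penalty v g) β₀ T w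
  have hu : Tendsto Prod.snd l (𝓝 u₀) :=
    tendsto_snd_minimizerFilter (convexOn_penalty hgc) hT hc hcT hmin
  have ht : Tendsto (fun y => y.1.1) l (𝓝[>] 0) := tendsto_fst.comp hfst
  have hpos : ∀ᶠ y in l, 0 < y.1.1 := ht.eventually self_mem_nhdsWithin
  have hmem : ∀ᶠ y in l, IsMinOn (localObjective (penalty v g) β₀ y.1) Set.univ y.2 :=
    eventually_minimizerFilter.2 (.of_forall fun _ _ h => h)
  have hAw : Tendsto (fun y => y.1.2) l (𝓝 (T, w)) := tendsto_snd.comp hfst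
  have hA : Tendsto (fun y => y.1.2.1) l (𝓝 T) := (continuous_fst.tendsto (T, w)).comp hAw
  have hw : Tendsto (fun y => y.1.2.2) l (𝓝 w) := (continuous_snd.tendsto (T, w)).comp hAw
  have hβ : Tendsto (fun y => β₀ + y.1.1 • y.2) l (𝓝 β₀) := by
    simpa using tendsto_const_nhds.add ((ht.mono_right nhdsWithin_le_nhds).smul hu)
  have hsub := eventually_pattern_subset_limitingPattern (v := v) β₀ ht hu
  -- A strictly smaller pattern `r` would force `w` onto the hyperplane attached to `(s, r)`.
  have hne : ∀ r, r ⊂ s → ∀ᶠ y in l, (∀ a b, ⟪y.1.2.1 a, b⟫ = ⟪a, y.1.2.1 b⟫) →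
      pattern v (β₀ + y.1.1 • y.2) ≠ r := by
    intro r hr
    by_cases hlt : tieSpace v s < tieSpace v r
    · obtain ⟨d, hdr, hdT, hdw⟩ := hgen r hlt
      have hlim : ∀ i ∈ r, ∀ᶠ y in l, ⟪y.1.2.1 y.2, d⟫ - ⟪y.1.2.2, d⟫
          + (⟪v i, d⟫ + fderiv ℝ g (β₀ + y.1.1 • y.2) d) ≠ 0 := by
        intro i hi
        have hg' : Tendsto (fun y => fderiv ℝ g (β₀ + y.1.1 • y.2) d) l (𝓝 (fderiv ℝ g β₀ d)) :=
          (((hg.continuous_fderiv one_ne_zero).clm_apply continuous_const).tendsto β₀).comp hβ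
        have hAu : Tendsto (fun y => y.1.2.1 y.2) l (𝓝 (T u₀)) :=
          ((continuous_fst.clm_apply continuous_snd).tendsto (T, u₀)).comp (hA.prodMk_nhds hu)
        have h := ((hAu.inner (tendsto_const_nhds (x := d))).sub
          (hw.inner (tendsto_const_nhds (x := d)))).add
          (hg'.const_add ⟪v i, d⟫)
        refine h.eventually_ne ?_
        rw [hdT u₀ (mem_tieSpace_limitingPattern β₀ u₀)]
        intro h0
        exact hdw i hi (by linarith)
      filter_upwards [eventually_all.2 fun i => eventually_imp_distrib_left.2 (hlim i), hpos, hmem]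
        with y hy hty hmin' hsymm heq
      obtain ⟨i, hi⟩ := pattern_nonempty v (β₀ + y.1.1 • y.2)
      exact hy i (heq ▸ hi) (inner_eq_of_isMinOn_localObjective (hg.differentiable one_ne_zero) hty
        hsymm hmin' (heq.symm ▸ hdr) hi)
    · refine .of_forall fun y _ heq => hlt ?_
      rw [← heq] at hr ⊢
      exact tieSpace_lt_of_pattern_ssubset hr
  have hfin : ∀ᶠ y in l, (∀ a b, ⟪y.1.2.1 a, b⟫ = ⟪a, y.1.2.1 b⟫) →
      pattern v (β₀ + y.1.1 • y.2) = s := by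
    filter_upwards [hsub, eventually_all.2 fun r => eventually_imp_distrib_left.2 (hne r)]
      with y hy hy' hsymm
    by_contra h
    exact hy' _ (hy.ssubset_of_ne h) hsymm rfl
  filter_upwards [eventually_minimizerFilter.1 hfin] with z hz hsymm u hu'
  exact hz u hu' hsymm

end LocalObjective

/-! ### Independence of pairs and convergence in distribution -/

section Probability

variable {Ω Ω' : Type*} [MeasurableSpace Ω] [MeasurableSpace Ω'] {P : Measure Ω} {P' : Measure Ω'}

/-- Pairing two independent families of independent random variables gives an independent family. -/
theorem iIndepFun_prodMk_of_indepFun {κ α β : Type*} [MeasurableSpace α] [MeasurableSpace β]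
    {X : κ → Ω → α} {Y : κ → Ω → β} (hX : iIndepFun X P) (hY : iIndepFun Y P)
    (hX_meas : ∀ i, Measurable (X i)) (hY_meas : ∀ i, Measurable (Y i))
    (hXY : IndepFun (fun ω i => X i ω) (fun ω i => Y i ω) P) :
    iIndepFun (fun i ω => (X i ω, Y i ω)) P := by
  rw [iIndepFun_iff_iIndep]
  refine iIndepSets.iIndep (fun i => ((hX_meas i).prodMk (hY_meas i)).comap_le)
    (fun i => {s | ∃ t ∈ Set.image2 (· ×ˢ ·) {A : Set α | MeasurableSet A}
      {B : Set β | MeasurableSet B}, (fun ω => (X i ω, Y i ω)) ⁻¹' t = s})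
    (fun i => isPiSystem_prod.comap _) (fun i => ?_) ((iIndepSets_iff _ _).2 fun s F hF => ?_)
  · rw [← generateFrom_prod, MeasurableSpace.comap_generateFrom]
    rfl
  have hAB : ∀ i, ∃ (A : Set α) (B : Set β), MeasurableSet A ∧ MeasurableSet B ∧
      (i ∈ s → F i = X i ⁻¹' A ∩ Y i ⁻¹' B) := by
    intro i
    by_cases hi : i ∈ s
    · obtain ⟨_, ⟨A, hA, B, hB, rfl⟩, h⟩ := hF i hi
      exact ⟨A, B, hA, hB, fun _ => h.symm⟩
    · exact ⟨∅, ∅, .empty, .empty, fun h => absurd h hi⟩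
  choose A B hA hB hF' using hAB
  have hpair : ∀ i, P (X i ⁻¹' A i ∩ Y i ⁻¹' B i) = P (X i ⁻¹' A i) * P (Y i ⁻¹' B i) := fun i =>
    indepFun_iff_measure_inter_preimage_eq_mul.1
      (hXY.comp (measurable_pi_apply i) (measurable_pi_apply i)) _ _ (hA i) (hB i)
  have hjoint : P ((⋂ i ∈ s, X i ⁻¹' A i) ∩ ⋂ i ∈ s, Y i ⁻¹' B i)
      = P (⋂ i ∈ s, X i ⁻¹' A i) * P (⋂ i ∈ s, Y i ⁻¹' B i) := by
    have h := indepFun_iff_measure_inter_preimage_eq_mul.1 hXY (⋂ i ∈ s, {x | x i ∈ A i})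
      (⋂ i ∈ s, {y | y i ∈ B i})
      (.biInter s.countable_toSet fun i _ => measurable_pi_apply i (hA i))
      (.biInter s.countable_toSet fun i _ => measurable_pi_apply i (hB i))
    simp only [Set.preimage_iInter] at h
    exact h
  calc P (⋂ i ∈ s, F i) = P ((⋂ i ∈ s, X i ⁻¹' A i) ∩ ⋂ i ∈ s, Y i ⁻¹' B i) := by
        congr 1
        simp only [← Set.iInter_inter_distrib]
        exact Set.iInter₂_congr hF'
    _ = ∏ i ∈ s, P (X i ⁻¹' A i) * P (Y i ⁻¹' B i) := by
        rw [hjoint, iIndepFun_iff_measure_inter_preimage_eq_mul.1 hX s fun i _ => hA i,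
          iIndepFun_iff_measure_inter_preimage_eq_mul.1 hY s fun i _ => hB i,
          Finset.prod_mul_distrib]
    _ = ∏ i ∈ s, P (F i) := Finset.prod_congr rfl fun i hi => by rw [hF' i hi, hpair]

/-- An extended mapping principle. If `Z n` converges to `Z` in distribution and, on the event `G`,
a property `R n` holds eventually near `Z`, then asymptotically `R n (Z n)` has at least the
probability of `G`. Neither `R` nor `G` needs to be measurable. -/
theorem measure_le_liminf_of_tendstoInDistribution {S : Type*} [TopologicalSpace S]
    [MeasurableSpace S] [BorelSpace S] [HasOuterApproxClosed S] {Z : ℕ → Ω → S} {Z' : Ω' → S}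
    [IsProbabilityMeasure P] [IsProbabilityMeasure P']
    (hZ : TendstoInDistribution Z atTop Z' (fun _ => P) P') {R : ℕ → S → Prop} {B : ℕ → Set Ω}
    (hB : ∀ n, ∀ᵐ ω ∂P, R n (Z n ω) → ω ∈ B n) {G : Set Ω'}
    (hG : ∀ᵐ ω ∂P', ω ∈ G → ∀ᶠ y in atTop ×ˢ 𝓝 (Z' ω), R y.1 y.2) :
    P' G ≤ liminf (fun n => P (B n)) atTop := by
  let O : ℕ → Set S := fun k => interior {z | ∀ n ≥ k, R n z}
  have hO : Monotone O := fun k m hkm => interior_mono fun z hz n hn => hz n (hkm.trans hn)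
  have hGO : P' G ≤ P' (Z' ⁻¹' ⋃ k, O k) := by
    refine measure_mono_ae ?_
    filter_upwards [hG] with ω hω hωG
    obtain ⟨a, ha, b, hb, hab⟩ := eventually_prod_iff.1 (hω hωG)
    obtain ⟨k, hk⟩ := eventually_atTop.1 ha
    refine Set.mem_iUnion.2 ⟨k, mem_interior_iff_mem_nhds.2 ?_⟩
    filter_upwards [hb] with z hz n hn
    exact hab (hk n hn) hz
  refine hGO.trans ?_
  rw [Set.preimage_iUnion, Monotone.measure_iUnion fun i j hij => Set.preimage_mono (hO hij)]
  refine iSup_le fun k => ?_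
  rw [← Measure.map_apply_of_aemeasurable hZ.aemeasurable_limit isOpen_interior.measurableSet]
  refine (ProbabilityMeasure.le_liminf_measure_open_of_tendsto hZ.tendsto isOpen_interior).trans ?_
  refine liminf_le_liminf ?_
  filter_upwards [eventually_ge_atTop k] with n hn
  rw [ProbabilityMeasure.coe_mk, Measure.map_apply_of_aemeasurable (hZ.forall_aemeasurable n)
    isOpen_interior.measurableSet]
  refine measure_mono_ae ?_
  filter_upwards [hB n] with ω hω hmem
  exact hω (interior_subset hmem n hn)

theorem charFun_map_inner {E : Type*} [NormedAddCommGroup E] [InnerProductSpace ℝ E]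
    [MeasurableSpace E] [BorelSpace E] [SecondCountableTopology E] {V : Ω → E} {U : Ω → ℝ} {t : E}
    (hV : AEMeasurable V P) (hU : ∀ ω, U ω = ⟪V ω, t⟫) :
    charFun (P.map U) 1 = charFun (P.map V) t := by
  obtain rfl : U = fun ω => ⟪V ω, t⟫ := funext hU
  rw [charFun_apply, charFun_apply, integral_map (by fun_prop) (by fun_prop),
    integral_map hV (by fun_prop)]
  simp

variable [IsProbabilityMeasure P] [IsProbabilityMeasure P']

/-- The multivariate central limit theorem, from the one-dimensional one applied to all projections
(Cramér–Wold). -/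
theorem tendstoInDistribution_inv_sqrt_smul_sum {E : Type*} [NormedAddCommGroup E]
    [InnerProductSpace ℝ E] [FiniteDimensional ℝ E] [MeasurableSpace E] [BorelSpace E]
    {Y : ℕ → Ω → E} (hY : MemLp (Y 0) 2 P) (hmean : ∀ t, ∫ ω, ⟪Y 0 ω, t⟫ ∂P = 0)
    (hindep : iIndepFun Y P) (hident : ∀ i, IdentDistrib (Y i) (Y 0) P P) {W : Ω' → E}
    (hW_meas : AEMeasurable W P') (hW : ∀ t, HasLaw (fun ω => ⟪W ω, t⟫)
      (gaussianReal 0 Var[fun ω => ⟪Y 0 ω, t⟫; P].toNNReal) P') :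
    TendstoInDistribution (fun (n : ℕ) ω => (√n)⁻¹ • ∑ k ∈ Finset.range n, Y k ω) atTop W
      (fun _ => P) P' where
  forall_aemeasurable n :=
    (Finset.aemeasurable_fun_sum _ fun _ _ => (hident _).aemeasurable_fst).const_smul _
  aemeasurable_limit := hW_meas
  tendsto := by
    have hS : ∀ n : ℕ, AEMeasurable (fun ω => (√n)⁻¹ • ∑ k ∈ Finset.range n, Y k ω) P := fun n =>
      (Finset.aemeasurable_fun_sum _ fun _ _ => (hident _).aemeasurable_fst).const_smul _
    refine ProbabilityMeasure.tendsto_iff_tendsto_charFun.2 fun t => ?_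
    have hclt := tendstoInDistribution_inv_sqrt_mul_sum_sub (X := fun k ω => ⟪Y k ω, t⟫) (P := P)
      (hW t) (hY.inner_const t) (hindep.comp (fun _ x => ⟪x, t⟫) fun _ => by fun_prop)
      fun i => (hident i).comp (u := fun x => ⟪x, t⟫) (by fun_prop)
    have h := ProbabilityMeasure.tendsto_iff_tendsto_charFun.1 hclt.tendsto 1
    have hlim := charFun_map_inner hW_meas (t := t) fun _ => rfl
    have hseq := fun n : ℕ => charFun_map_inner (hS n) (t := t)
      (U := fun ω => (√n)⁻¹ * (∑ k ∈ Finset.range n, ⟪Y k ω, t⟫ - n * ∫ ω, ⟪Y 0 ω, t⟫ ∂P))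
      fun ω => by simp [real_inner_smul_left, sum_inner, hmean]
    simpa only [ProbabilityMeasure.coe_mk, hlim, hseq] using h

end Probability

/-! ### Limits of the empirical moments -/

section Moments

variable {p : ℕ} {C : Matrix (Fin p) (Fin p) ℝ}

theorem inner_toEuclideanCLM_comm (hC : C.IsHermitian) (x y : 𝐄[p]) :
    ⟪Matrix.toEuclideanCLM (𝕜 := ℝ) C x, y⟫ = ⟪x, Matrix.toEuclideanCLM (𝕜 := ℝ) C y⟫ := by
  rw [← ContinuousLinearMap.adjoint_inner_right, ← ContinuousLinearMap.star_eq_adjoint, ← map_star,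
    Matrix.star_eq_conjTranspose, hC.eq]

theorem inner_toEuclideanCLM_pos (hC : C.PosDef) {x : 𝐄[p]} (hx : x ≠ 0) :
    0 < ⟪Matrix.toEuclideanCLM (𝕜 := ℝ) C x, x⟫ := by
  rw [inner_toEuclideanCLM_comm hC.isHermitian, Matrix.inner_toEuclideanCLM]
  simpa using hC.dotProduct_mulVec_pos (x := x.ofLp) (by simpa using hx)

/-- A positive definite matrix is coercive, by compactness of the unit sphere. -/
theorem exists_pos_mul_sq_norm_le_inner_toEuclideanCLM (hC : C.PosDef) :
    ∃ c > 0, ∀ x : 𝐄[p], c * ‖x‖ ^ 2 ≤ ⟪Matrix.toEuclideanCLM (𝕜 := ℝ) C x, x⟫ := by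
  rcases (Metric.sphere (0 : 𝐄[p]) 1).eq_empty_or_nonempty with hempty | hne
  · refine ⟨1, one_pos, fun x => ?_⟩
    have hx : x = 0 := by
      by_contra hx
      have : (‖x‖⁻¹ : ℝ) • x ∈ Metric.sphere (0 : 𝐄[p]) 1 := by simp [norm_smul, hx]
      simp [hempty] at this
    simp [hx]
  · obtain ⟨y, hy, hmin⟩ := (isCompact_sphere (0 : 𝐄[p]) 1).exists_isMinOn hne
      (f := fun x => ⟪Matrix.toEuclideanCLM (𝕜 := ℝ) C x, x⟫) (by fun_prop)
    refine ⟨_, inner_toEuclideanCLM_pos hC (Metric.ne_of_mem_sphere hy one_ne_zero), fun x => ?_⟩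
    rcases eq_or_ne x 0 with rfl | hx
    · simp
    have h := hmin (a := (‖x‖⁻¹ : ℝ) • x) (by simp [norm_smul, hx])
    simp only [Set.mem_ofPred_eq, map_smul, real_inner_smul_left, real_inner_smul_right] at h
    have hn : 0 < ‖x‖ := norm_pos_iff.2 hx
    calc _ ≤ ‖x‖⁻¹ * (‖x‖⁻¹ * ⟪Matrix.toEuclideanCLM (𝕜 := ℝ) C x, x⟫) * ‖x‖ ^ 2 := by gcongr
      _ = _ := by field_simp

variable {Ω : Type*} [MeasurableSpace Ω] {P : Measure Ω} [IsProbabilityMeasure P]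

theorem integral_inner_eq_zero {Y : Ω → 𝐄[p]} (hY : MemLp Y 2 P) (hmean : ∫ ω, Y ω ∂P = 0)
    (t : 𝐄[p]) : ∫ ω, ⟪Y ω, t⟫ ∂P = 0 := by
  simp_rw [real_inner_comm t]
  rw [integral_inner (hY.integrable one_le_two), hmean, inner_zero_right]

theorem integral_inner_mul_inner {Y : Ω → 𝐄[p]} (hY : MemLp Y 2 P) (hmean : ∫ ω, Y ω ∂P = 0)
    (hcov : ∀ j k, cov[fun ω => Y ω j, fun ω => Y ω k; P] = C j k) (s t : 𝐄[p]) :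
    ∫ ω, ⟪Y ω, s⟫ * ⟪Y ω, t⟫ ∂P = ⟪s, Matrix.toEuclideanCLM (𝕜 := ℝ) C t⟫ := by
  have hYj : ∀ j, MemLp (fun ω => Y ω j) 2 P := fun j => by
    simpa [EuclideanSpace.inner_single_right] using
      hY.inner_const (𝕜 := ℝ) (EuclideanSpace.single j (1 : ℝ))
  have hcoord : ∀ r : 𝐄[p], (fun ω => ⟪Y ω, r⟫) = fun ω => ∑ j, r j * Y ω j := fun r => by
    ext ω
    simp [PiLp.inner_apply]
  have h := covariance_eq_sub (hY.inner_const (𝕜 := ℝ) s) (hY.inner_const (𝕜 := ℝ) t)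
  rw [integral_inner_eq_zero hY hmean, zero_mul, sub_zero, hcoord, hcoord,
    covariance_fun_sum_fun_sum (fun j => (hYj j).const_mul _) (fun j => (hYj j).const_mul _),
    ← hcoord, ← hcoord] at h
  rw [show ∫ ω, ⟪Y ω, s⟫ * ⟪Y ω, t⟫ ∂P = _ from h.symm, Matrix.inner_toEuclideanCLM]
  simp_rw [covariance_const_mul_left, covariance_const_mul_right, hcov]
  simp only [dotProduct, Matrix.mulVec, Finset.mul_sum]
  simp [mul_comm, mul_left_comm]

theorem continuous_rankOne_self (p : ℕ) :
    Continuous fun x : 𝐄[p] => InnerProductSpace.rankOne ℝ x x := by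
  change Continuous fun x : 𝐄[p] =>
    ContinuousLinearMap.smulRightL ℝ 𝐄[p] 𝐄[p] (innerSL ℝ x) x
  fun_prop

/-- The empirical second moment operators converge almost surely, by the strong law of large
numbers in the space of operators. -/
theorem ae_tendsto_secondMoment {X : ℕ → Ω → 𝐄[p]} (hC : C.IsHermitian)
    (hX_indep : iIndepFun X P) (hX_ident : ∀ i, IdentDistrib (X i) (X 0) P P)
    (hX : MemLp (X 0) 2 P) (hmean : ∫ ω, X 0 ω ∂P = 0)
    (hcov : ∀ j k, cov[fun ω => X 0 ω j, fun ω => X 0 ω k; P] = C j k) :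
    ∀ᵐ ω ∂P, Tendsto (fun n : ℕ => (n : ℝ)⁻¹ • ∑ i ∈ Finset.range n,
      InnerProductSpace.rankOne ℝ (X i ω) (X i ω)) atTop
      (𝓝 (Matrix.toEuclideanCLM (𝕜 := ℝ) C)) := by
  have hcont := continuous_rankOne_self p
  have hint : Integrable (fun ω => InnerProductSpace.rankOne ℝ (X 0 ω) (X 0 ω)) P := by
    refine ((memLp_two_iff_integrable_sq_norm hX.1).1 hX).mono'
      (hcont.comp_aestronglyMeasurable hX.1) (.of_forall fun ω => ?_)
    simp [pow_two]
  have hlim : ∫ ω, InnerProductSpace.rankOne ℝ (X 0 ω) (X 0 ω) ∂P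
      = Matrix.toEuclideanCLM (𝕜 := ℝ) C := by
    refine ContinuousLinearMap.ext fun s => ext_inner_right ℝ fun t => ?_
    rw [ContinuousLinearMap.integral_apply hint, real_inner_comm,
      ← integral_inner (hint.apply_continuousLinearMap s), inner_toEuclideanCLM_comm hC,
      ← integral_inner_mul_inner hX hmean hcov]
    refine integral_congr_ae (.of_forall fun ω => ?_)
    simp [real_inner_smul_right, real_inner_comm t]
  rw [← hlim]
  exact strong_law_ae (fun i ω => InnerProductSpace.rankOne ℝ (X i ω) (X i ω)) hint
    (fun i j hij => (hX_indep.indepFun hij).comp hcont.measurable hcont.measurable)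
    fun i => (hX_ident i).comp hcont.measurable

variable {Ω' : Type*} [MeasurableSpace Ω'] {P' : Measure Ω'}

theorem hasLaw_inner_multivariateGaussian {S : Matrix (Fin p) (Fin p) ℝ} (hS : S.PosSemidef)
    {W : Ω' → 𝐄[p]} (hW : HasLaw W (multivariateGaussian 0 S) P') (t : 𝐄[p]) :
    HasLaw (fun ω => ⟪W ω, t⟫)
      (gaussianReal 0 (⟪t, Matrix.toEuclideanCLM (𝕜 := ℝ) S t⟫).toNNReal) P' := by
  have hlaw : HasLaw (fun x : 𝐄[p] => ⟪t, x⟫)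
      (gaussianReal 0 (⟪t, Matrix.toEuclideanCLM (𝕜 := ℝ) S t⟫).toNNReal)
      (multivariateGaussian 0 S) := by
    refine ⟨by fun_prop, ?_⟩
    have h := IsGaussian.map_eq_gaussianReal (μ := multivariateGaussian 0 S) (innerSL ℝ t)
    have hmean : ∫ x, innerSL ℝ t x ∂(multivariateGaussian 0 S) = 0 := by
      rw [ContinuousLinearMap.integral_comp_comm _ IsGaussian.integrable_fun_id]
      simp
    have hvar : Var[innerSL ℝ t; multivariateGaussian 0 S]
        = ⟪t, Matrix.toEuclideanCLM (𝕜 := ℝ) S t⟫ := by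
      rw [Matrix.inner_toEuclideanCLM, ← covarianceBilin_multivariateGaussian (μ := 0) hS,
        covarianceBilin_self IsGaussian.memLp_two_id]
      rfl
    rw [hmean, hvar] at h
    exact h
  simp_rw [real_inner_comm t]
  exact hlaw.comp hW

/-- A Gaussian vector with positive definite covariance avoids every hyperplane. -/
theorem ae_inner_ne_of_hasLaw_multivariateGaussian {S : Matrix (Fin p) (Fin p) ℝ} (hS : S.PosDef)
    {W : Ω' → 𝐄[p]} (hW : HasLaw W (multivariateGaussian 0 S) P') {d : 𝐄[p]} (hd : d ≠ 0) (a : ℝ) :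
    ∀ᵐ ω ∂P', ⟪W ω, d⟫ ≠ a := by
  have hlaw := hasLaw_inner_multivariateGaussian hS.posSemidef hW d
  have hv : (⟪d, Matrix.toEuclideanCLM (𝕜 := ℝ) S d⟫).toNNReal ≠ 0 := by
    simpa [← inner_toEuclideanCLM_comm hS.isHermitian] using inner_toEuclideanCLM_pos hS hd
  have := nullSingletonClass_gaussianReal (μ := 0) hv
  refine (hlaw.ae_iff (p := fun x => x ≠ a) ?_).2 ?_
  · exact measurableSet_setOfPred.1 (measurableSet_singleton a).compl
  · exact compl_mem_ae_iff.2 (measure_singleton a)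

/-- The rescaled noise `n^{-1/2} ∑ εᵢ Xᵢ` converges in distribution to `𝒩(0, σ² C)`. -/
theorem tendstoInDistribution_noise [IsProbabilityMeasure P'] (hC : C.PosSemidef) {σ : ℝ}
    {X : ℕ → Ω → 𝐄[p]} {ε : ℕ → Ω → ℝ}
    (hX_meas : ∀ i, Measurable (X i)) (hε_meas : ∀ i, Measurable (ε i))
    (hX_indep : iIndepFun X P) (hX_ident : ∀ i, IdentDistrib (X i) (X 0) P P)
    (hX : MemLp (X 0) 2 P) (hX_mean : ∫ ω, X 0 ω ∂P = 0)
    (hX_cov : ∀ j k, cov[fun ω => X 0 ω j, fun ω => X 0 ω k; P] = C j k)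
    (hε_indep : iIndepFun ε P) (hε_ident : ∀ i, IdentDistrib (ε i) (ε 0) P P)
    (hε : MemLp (ε 0) 2 P) (hε_mean : ∫ ω, ε 0 ω ∂P = 0)
    (hε_var : Var[ε 0; P] = σ ^ 2)
    (hXε : IndepFun (fun ω i => X i ω) (fun ω i => ε i ω) P)
    {W : Ω' → 𝐄[p]} (hW : HasLaw W (multivariateGaussian 0 (σ ^ 2 • C)) P') :
    TendstoInDistribution (fun (n : ℕ) ω => (√n)⁻¹ • ∑ k ∈ Finset.range n, ε k ω • X k ω) atTop W
      (fun _ => P) P' := by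
  have hXε' : ∀ i, IndepFun (X i) (ε i) P := fun i =>
    hXε.comp (measurable_pi_apply i) (measurable_pi_apply i)
  have hφ : Measurable fun y : 𝐄[p] × ℝ => y.2 • y.1 := by fun_prop
  have hmemLp : MemLp (fun ω => ε 0 ω • X 0 ω) 2 P := by
    refine (memLp_two_iff_integrable_sq_norm (by fun_prop)).2 ?_
    have h := ((hXε' 0).symm.comp (measurable_id.pow_const 2)
      (measurable_norm.pow_const 2)).integrable_mul hε.integrable_sq
        ((memLp_two_iff_integrable_sq_norm hX.1).1 hX)
    refine h.congr (.of_forall fun ω => ?_)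
    simp [norm_smul, mul_pow]
  have hmean : ∀ t, ∫ ω, ⟪ε 0 ω • X 0 ω, t⟫ ∂P = 0 := fun t => by
    simp_rw [real_inner_smul_left]
    have h := ((hXε' 0).symm.comp measurable_id
      (by fun_prop : Measurable fun x : 𝐄[p] => ⟪x, t⟫)).integral_fun_mul_eq_mul_integral
      (by fun_prop) (by fun_prop)
    refine h.trans ?_
    simp [hε_mean]
  have hvar : ∀ t, Var[fun ω => ⟪ε 0 ω • X 0 ω, t⟫; P]
      = ⟪t, Matrix.toEuclideanCLM (𝕜 := ℝ) (σ ^ 2 • C) t⟫ := fun t => by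
    rw [variance_of_integral_eq_zero (by fun_prop) (hmean t)]
    simp_rw [real_inner_smul_left, mul_pow]
    have h := ((hXε' 0).symm.comp (measurable_id.pow_const 2)
      (by fun_prop : Measurable fun x : 𝐄[p] => ⟪x, t⟫ ^ 2)).integral_fun_mul_eq_mul_integral
      (by fun_prop) (by fun_prop)
    refine h.trans ?_
    have h1 : ∫ ω, ε 0 ω ^ 2 ∂P = σ ^ 2 := by
      rw [← hε_var, variance_of_integral_eq_zero (hε_meas 0).aemeasurable hε_mean]
    have h2 := integral_inner_mul_inner hX hX_mean hX_cov t t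
    simp only [← pow_two] at h2
    simp only [Function.comp_def, id, h1, h2]
    simp [real_inner_smul_right]
  refine tendstoInDistribution_inv_sqrt_smul_sum (Y := fun i ω => ε i ω • X i ω) hmemLp hmean
    ((iIndepFun_prodMk_of_indepFun hX_indep hε_indep hX_meas hε_meas hXε).comp
      (fun _ y => y.2 • y.1) fun _ => hφ)
    (fun i => ?_) hW.aemeasurable fun t => ?_
  · have h : IdentDistrib (fun ω => (X i ω, ε i ω)) (fun ω => (X 0 ω, ε 0 ω)) P P :=
      (hX_ident i).prodMk (hε_ident i) (hXε' i) (hXε' 0)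
    exact h.comp hφ
  · rw [hvar]
    exact hasLaw_inner_multivariateGaussian (hC.smul (sq_nonneg σ)) hW t

end Moments

/-! ### The regression objective in the local coordinate -/

section Regression

variable {p : ℕ} {Ω : Type*}

/-- The scale `n^{-1/2}`, the empirical second moment operator and the rescaled noise of the
regression with `n` observations. -/
noncomputable def localParameter (X : ℕ → Ω → 𝐄[p]) (ε : ℕ → Ω → ℝ) (n : ℕ) (ω : Ω) :
    ℝ × (𝐄[p] →L[ℝ] 𝐄[p]) × 𝐄[p] :=
  ((√n)⁻¹, (n : ℝ)⁻¹ • ∑ i ∈ Finset.range n, InnerProductSpace.rankOne ℝ (X i ω) (X i ω),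
    (√n)⁻¹ • ∑ i ∈ Finset.range n, ε i ω • X i ω)

theorem objective_eq_localObjective_add (X : ℕ → Ω → 𝐄[p]) (ε : ℕ → Ω → ℝ) (β₀ : 𝐄[p])
    (f : 𝐄[p] → ℝ) {n : ℕ} (hn : 0 < n) (ω : Ω) (u : 𝐄[p]) :
    objective X ε β₀ f n ω (β₀ + (√n)⁻¹ • u)
      = localObjective f β₀ (localParameter X ε n ω) u
        + (1 / 2 * ∑ i ∈ Finset.range n, ε i ω ^ 2 + √n * f β₀) := by
  have hn' : (0 : ℝ) < n := by exact_mod_cast hn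
  have hs : (0 : ℝ) < √n := Real.sqrt_pos.2 hn'
  have hmul : ∀ (x : 𝐄[p]) (i : Fin n), (designMatrix X n ω *ᵥ x.ofLp) i = ⟪X i ω, x⟫ := by
    intro x i
    simp [designMatrix, Matrix.mulVec, dotProduct, PiLp.inner_apply, mul_comm]
  have hres : ∀ i : Fin n, (response X ε β₀ n ω
      - designMatrix X n ω *ᵥ (β₀ + (√n)⁻¹ • u).ofLp) i = ε i ω - (√n)⁻¹ * ⟪X i ω, u⟫ := by
    intro i
    simp only [response, Pi.sub_apply, Pi.add_apply, hmul, inner_add_right, real_inner_smul_right]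
    ring
  have hA : ⟪(n : ℝ)⁻¹ • (∑ i ∈ Finset.range n,
      InnerProductSpace.rankOne ℝ (X i ω) (X i ω)) u, u⟫
      = (n : ℝ)⁻¹ * ∑ i ∈ Finset.range n, ⟪X i ω, u⟫ ^ 2 := by
    simp [real_inner_smul_left, sum_inner, pow_two]
  have hw : ⟪(√n)⁻¹ • ∑ i ∈ Finset.range n, ε i ω • X i ω, u⟫
      = (√n)⁻¹ * ∑ i ∈ Finset.range n, ε i ω * ⟪X i ω, u⟫ := by
    simp [real_inner_smul_left, sum_inner]
  have hsq : ∑ i ∈ Finset.range n, (ε i ω - (√n)⁻¹ * ⟪X i ω, u⟫) ^ 2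
      = ∑ i ∈ Finset.range n, ε i ω ^ 2 - 2 * ((√n)⁻¹ * ∑ i ∈ Finset.range n, ε i ω * ⟪X i ω, u⟫)
        + (n : ℝ)⁻¹ * ∑ i ∈ Finset.range n, ⟪X i ω, u⟫ ^ 2 := by
    have hsn : (n : ℝ)⁻¹ = (√n)⁻¹ ^ 2 := by rw [inv_pow, Real.sq_sqrt hn'.le]
    rw [hsn]
    simp only [Finset.mul_sum, ← Finset.sum_sub_distrib, ← Finset.sum_add_distrib]
    exact Finset.sum_congr rfl fun i _ => by ring
  simp only [objective, localObjective, localParameter, EuclideanSpace.real_norm_sq_eq, hres,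
    smul_apply, hA, hw]
  rw [← Finset.sum_range fun i => (ε i ω - (√n)⁻¹ * ⟪X i ω, u⟫) ^ 2, hsq, div_inv_eq_mul]
  ring

/-- The change of variables `β = β₀ + u / √n` carries minimizers to minimizers. -/
theorem isMinOn_objective_iff (X : ℕ → Ω → 𝐄[p]) (ε : ℕ → Ω → ℝ) (β₀ : 𝐄[p])
    (f : 𝐄[p] → ℝ) {n : ℕ} (hn : 0 < n) (ω : Ω) (u : 𝐄[p]) :
    IsMinOn (objective X ε β₀ f n ω) Set.univ (β₀ + (√n)⁻¹ • u) ↔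
      IsMinOn (localObjective f β₀ (localParameter X ε n ω)) Set.univ u := by
  have hs : √(n : ℝ) ≠ 0 := by positivity
  simp only [isMinOn_univ_iff, objective_eq_localObjective_add X ε β₀ f hn]
  refine ⟨fun h y => ?_, fun h b => ?_⟩
  · have := h (β₀ + (√n)⁻¹ • y)
    rwa [objective_eq_localObjective_add X ε β₀ f hn, add_le_add_iff_right] at this
  · obtain ⟨y, rfl⟩ : ∃ y, b = β₀ + (√n)⁻¹ • y := ⟨√n • (b - β₀), by simp [smul_smul, hs]⟩
    rw [objective_eq_localObjective_add X ε β₀ f hn, add_le_add_iff_right]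
    exact h y

end Regression

/-! ### Convergence of the pattern probabilities -/

section Convergence

variable {p : ℕ} {ι : Type*} {v : ι → 𝐄[p]} {g : 𝐄[p] → ℝ} {β₀ : 𝐄[p]}
  {C : Matrix (Fin p) (Fin p) ℝ}

theorem limitObjective_eq (f : 𝐄[p] → ℝ) (hC : C.IsHermitian) (w : 𝐄[p]) :
    limitObjective C β₀ f w = fun u => 1 / 2 * ⟪Matrix.toEuclideanCLM (𝕜 := ℝ) C u, u⟫ - ⟪w, u⟫
      + dirDeriv f β₀ u := by
  ext u
  rw [inner_toEuclideanCLM_comm hC, Matrix.inner_toEuclideanCLM, limitObjective]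
  simp [EuclideanSpace.inner_eq_star_dotProduct]

/-- Almost every realization of the Gaussian limit avoids the hyperplanes on which the pattern of
the minimizer could be unstable; there are finitely many of them, one for each pair of tie
spaces and each active index. -/
theorem ae_forall_exists_mem_tieSpace_inner_ne [Finite ι] (β₀ : 𝐄[p]) (g : 𝐄[p] → ℝ)
    (v : ι → 𝐄[p]) (T : 𝐄[p] →L[ℝ] 𝐄[p])
    {Ω' : Type*} [MeasurableSpace Ω'] {P' : Measure Ω'} {S : Matrix (Fin p) (Fin p) ℝ}
    (hS : S.PosDef) {W : Ω' → 𝐄[p]} (hW : HasLaw W (multivariateGaussian 0 S) P') :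
    ∀ᵐ ω ∂P', ∀ s r, tieSpace v s < tieSpace v r → ∃ d ∈ tieSpace v r,
      (∀ u ∈ tieSpace v s, ⟪T u, d⟫ = 0) ∧ ∀ i ∈ r, ⟪W ω, d⟫ ≠ ⟪v i, d⟫ + fderiv ℝ g β₀ d := by
  refine ae_all_iff.2 fun s => ae_all_iff.2 fun r => ?_
  by_cases h : tieSpace v s < tieSpace v r
  · obtain ⟨d, hd0, hdr, hdT⟩ := exists_ne_zero_mem_tieSpace_inner_eq_zero T h
    filter_upwards [ae_all_iff.2 fun i => ae_inner_ne_of_hasLaw_multivariateGaussian hS hW hd0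
      (⟪v i, d⟫ + fderiv ℝ g β₀ d)] with ω hω _
    exact ⟨d, hdr, hdT, fun i _ => hω i⟩
  · exact .of_forall fun _ h' => absurd h' h

theorem measurableSet_pattern_eq [Finite ι] (v : ι → 𝐄[p]) (s : Set ι) :
    MeasurableSet {x | pattern v x = s} := by
  have h : {x | pattern v x = s} = {x | ∀ i, (∀ j, ⟪v j, x⟫ ≤ ⟪v i, x⟫) ↔ i ∈ s} := by
    ext x
    simp [Set.ext_iff, pattern]
  rw [h]
  refine measurableSet_setOfPred.2 (.forall fun i => .iff (.forall fun j => ?_) measurable_const)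
  exact measurableSet_setOfPred.1 (measurableSet_le (by fun_prop) (by fun_prop))

end Convergence

end PatternConvergence

open PatternConvergence in
theorem corollary1
    {p : ℕ} {ι : Type*} [Fintype ι] [Nonempty ι]
    -- the penalty: vertices `v i`, none in the convex hull of the others, and a smooth part `g`
    (v : ι → EuclideanSpace ℝ (Fin p))
    (hv : ∀ i, v i ∉ convexHull ℝ (v '' {j | j ≠ i}))
    (g : EuclideanSpace ℝ (Fin p) → ℝ)
    (hg : ContDiff ℝ 1 g) (hg_convex : ConvexOn ℝ Set.univ g)
    -- the linear model
    {Ω : Type*} [MeasurableSpace Ω] (P : Measure Ω) [IsProbabilityMeasure P]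
    (β₀ : EuclideanSpace ℝ (Fin p)) (C : Matrix (Fin p) (Fin p) ℝ) (hC : C.PosDef)
    (σ : ℝ) (hσ : 0 < σ)
    (X : ℕ → Ω → EuclideanSpace ℝ (Fin p)) (ε : ℕ → Ω → ℝ)
    (hX_meas : ∀ i, Measurable (X i)) (hε_meas : ∀ i, Measurable (ε i))
    (hX_indep : iIndepFun X P) (hX_ident : ∀ i, IdentDistrib (X i) (X 0) P P)
    (hX_memLp : MemLp (X 0) 2 P) (hX_mean : ∫ ω, X 0 ω ∂P = 0)
    (hX_cov : ∀ j k, cov[fun ω => X 0 ω j, fun ω => X 0 ω k; P] = C j k)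
    (hε_indep : iIndepFun ε P) (hε_ident : ∀ i, IdentDistrib (ε i) (ε 0) P P)
    (hε_memLp : MemLp (ε 0) 2 P) (hε_mean : ∫ ω, ε 0 ω ∂P = 0)
    (hε_var : Var[ε 0; P] = σ ^ 2)
    (hXε : IndepFun (fun ω i => X i ω) (fun ω i => ε i ω) P)
    -- the estimator: a minimizer of the objective, whenever there is one
    (βhat : ℕ → Ω → EuclideanSpace ℝ (Fin p)) (hβhat_meas : ∀ n, AEMeasurable (βhat n) P)
    (hβhat : ∀ n, ∀ᵐ ω ∂P,
      (∃ b, IsMinOn (PatternConvergence.objective X ε β₀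
        (PatternConvergence.penalty v g) n ω) Set.univ b) →
      IsMinOn (PatternConvergence.objective X ε β₀
        (PatternConvergence.penalty v g) n ω) Set.univ (βhat n ω))
    -- the asymptotic error: the minimizer of the limiting objective
    {Ω' : Type*} [MeasurableSpace Ω'] (P' : Measure Ω') [IsProbabilityMeasure P']
    (W : Ω' → EuclideanSpace ℝ (Fin p))
    (hW : HasLaw W (multivariateGaussian 0 (σ ^ 2 • C)) P')
    (uhat : Ω' → EuclideanSpace ℝ (Fin p))
    (huhat : ∀ᵐ ω ∂P', IsMinOn (PatternConvergence.limitObjective C β₀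
      (PatternConvergence.penalty v g) (W ω)) Set.univ (uhat ω)) :
    (∀ u, ∀ᶠ t in 𝓝[>] (0 : ℝ),
      PatternConvergence.pattern v (β₀ + t • u) = PatternConvergence.limitingPattern v β₀ u) ∧
    ∀ 𝔭 ∈ Set.range (PatternConvergence.pattern v),
      Tendsto (fun n => P {ω | PatternConvergence.pattern v (βhat n ω) = 𝔭}) atTop
        (𝓝 (P' {ω | PatternConvergence.limitingPattern v β₀ (uhat ω) = 𝔭})) := by
  refine ⟨eventually_pattern_eq_limitingPattern β₀, fun s _ => ?_⟩
  set T := Matrix.toEuclideanCLM (𝕜 := ℝ) C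
  have hTsymm := inner_toEuclideanCLM_comm hC.isHermitian
  obtain ⟨c, hc, hcT⟩ := exists_pos_mul_sq_norm_le_inner_toEuclideanCLM hC
  have hZ : TendstoInDistribution (fun n ω => ((localParameter X ε n ω).2.2,
      (localParameter X ε n ω).2.1)) atTop (fun ω => (W ω, T)) (fun _ => P) P' := by
    have hA : ∀ n, AEStronglyMeasurable (fun ω => (localParameter X ε n ω).2.1) P := fun n => by
      have h := Finset.aestronglyMeasurable_fun_sum (μ := P) (Finset.range n) fun i _ =>
        ((continuous_rankOne_self p).measurable.comp (hX_meas i)).aestronglyMeasurable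
      exact h.const_smul (n : ℝ)⁻¹
    exact (tendstoInDistribution_noise hC.posSemidef hX_meas hε_meas hX_indep hX_ident hX_memLp
      hX_mean hX_cov hε_indep hε_ident hε_memLp hε_mean hε_var hXε
      hW).prodMk_of_tendstoInMeasure_const _ _ _ (tendstoInMeasure_of_tendsto_ae hA
        (ae_tendsto_secondMoment hC.isHermitian hX_indep hX_ident hX_memLp hX_mean hX_cov))
      fun n => (hA n).aemeasurable
  -- The lower bound below is used for the pattern `s` and for its complement.
  have key : ∀ Q : Set (Set ι), P' {ω | limitingPattern v β₀ (uhat ω) ∈ Q}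
      ≤ liminf (fun n => P {ω | pattern v (βhat n ω) ∈ Q}) atTop := by
    intro Q
    -- `0 < n` rules out the degenerate scale `(√0)⁻¹ = 0`.
    refine measure_le_liminf_of_tendstoInDistribution hZ (R := fun n y => 0 < n ∧
      ((∀ a b, ⟪y.2 a, b⟫ = ⟪a, y.2 b⟫) →
        (∃ u, IsMinOn (localObjective (penalty v g) β₀ ((√n)⁻¹, y.2, y.1)) Set.univ u) ∧
        ∀ u, IsMinOn (localObjective (penalty v g) β₀ ((√n)⁻¹, y.2, y.1)) Set.univ u →
          pattern v (β₀ + (√n)⁻¹ • u) ∈ Q)) (fun n => ?_) ?_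
    · filter_upwards [hβhat n] with ω hω ⟨hn, hR⟩
      have hs : √(n : ℝ) ≠ 0 := by positivity
      obtain ⟨⟨u, hu⟩, hpat⟩ := hR (by
        intro a b
        simp [localParameter, real_inner_smul_right, inner_sum, real_inner_comm, mul_comm])
      have hmin := hω ⟨_, (isMinOn_objective_iff X ε β₀ _ hn ω u).2 hu⟩
      have hβ : βhat n ω = β₀ + (√n)⁻¹ • √n • (βhat n ω - β₀) := by simp [smul_smul, hs]
      rw [hβ, isMinOn_objective_iff X ε β₀ _ hn] at hmin
      have := hpat _ hmin
      rwa [← hβ] at this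
    · filter_upwards [huhat, ae_forall_exists_mem_tieSpace_inner_ne β₀ g v T
        (hC.smul (pow_pos hσ 2)) hW] with ω hω hgen hQ
      rw [limitObjective_eq _ hC.isHermitian] at hω
      have hφ : Tendsto (fun y : ℕ × EuclideanSpace ℝ (Fin p) ×
          (EuclideanSpace ℝ (Fin p) →L[ℝ] EuclideanSpace ℝ (Fin p)) => ((√y.1)⁻¹, y.2.2, y.2.1))
          (atTop ×ˢ 𝓝 (W ω, T)) (𝓝[>] 0 ×ˢ 𝓝 (T, W ω)) := by
        refine Tendsto.prodMap (f := fun n : ℕ => (√(n : ℝ))⁻¹) ?_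
          (continuous_swap.tendsto (W ω, T))
        exact tendsto_inv_atTop_nhdsGT_zero.comp
          (Real.tendsto_sqrt_atTop.comp tendsto_natCast_atTop_atTop)
      filter_upwards [hφ.eventually (eventually_exists_isMinOn_localObjective
          (convexOn_penalty hg_convex) (continuous_penalty hg.continuous) hTsymm hc hcT hω),
        hφ.eventually (eventually_pattern_eq_of_isMinOn_localObjective hg hg_convex hTsymm hc hcT hω
          (hgen _)), tendsto_fst.eventually (eventually_gt_atTop 0)] with y hex hpat hn
      exact ⟨hn, fun hsymm => ⟨hex, fun u hu => (hpat hsymm u hu).symm ▸ hQ⟩⟩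
  refine tendsto_of_le_liminf_of_limsup_le (key {s}) ?_
  have hcompl : ∀ n, P {ω | pattern v (βhat n ω) = s}
      = 1 - P {ω | pattern v (βhat n ω) ∈ ({s}ᶜ : Set (Set ι))} := fun n => by
    have hmeas : NullMeasurableSet {ω | pattern v (βhat n ω) = s} P :=
      (hβhat_meas n).nullMeasurableSet_preimage (measurableSet_pattern_eq v s)
    have h := prob_compl_eq_one_sub₀ hmeas.compl
    rwa [compl_compl] at h
  simp_rw [hcompl]
  rw [ENNReal.limsup_const_sub _ _ ENNReal.one_ne_top]
  refine (tsub_le_tsub_left (key {s}ᶜ) 1).trans (tsub_le_iff_right.2 ?_)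
  refine (measure_univ (μ := P')).symm.trans_le ((measure_mono fun ω _ => ?_).trans
    (measure_union_le _ _))
  exact em (limitingPattern v β₀ (uhat ω) = s)
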